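/- All Hilbert spaces are finite-dimensional. A coarse-graining is a finite family $\{\mathcal A_i\}_i$ of completely positive linear maps from the operators on one Hilbert space to the operators on another (possibly the same) such that $\sum_i\mathcal A_i$ is trace-preserving. Let $n\ge 1$, let $\mathcal C^{n+1}=(\mathcal C_1,\dots,\mathcal C_{n+1})$ be a sequence of composable coarse-grainings $\mathcal C_k=\{\mathcal A^k_{i_k}\}$, and let $\mathcal C^n=(\mathcal C_1,\dots,\mathcal C_n)$. For $m\in\{n,n+1\}$ and a multi-index $i^m=(i_1,\dots,i_m)$ put $\mathcal A_{i^m}=\mathcal A^m_{i_m}\circ\cdots\circ\mathcal A^1_{i_1}$, and let $\Pi_{i^m}=\mathcal A_{i^m}^\dagger(\mathbb 1)$, where $\dagger$ is the trace-dual. Let $\rho$ be a density operator on the initial space, of dimension $d$. Put $p_{i^m}=\operatorname{Tr}[\mathcal A_{i^m}(\rho)]$, $V_{i^m}=\operatorname{Tr}[\Pi_{i^m}]$ and $$S_{\mathcal C^m}(\rho)=-\sum_{i^m}p_{i^m}\ln\frac{p_{i^m}}{V_{i^m}},$$ where terms with $p_{i^m}=0$ count as $0$. Let $\boldsymbol p_{n+1}=(p_{i^{n+1}})_{i^{n+1}}$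 and $\boldsymbol q_{n+1}=\bigl(\tfrac{V_{i^{n+1}}}{V_{i^n}}\,p_{i^n}\bigr)_{i^{n+1}}$, where $i^n$ consists of the first $n$ entries of $i^{n+1}$ and entries with $p_{i^n}=0$ are $0$. Let $\rho_{i^n}=\mathcal A_{i^n}(\rho)/p_{i^n}$ and $\sigma_{i^n}=\mathcal A_{i^n}(\mathbb 1/d)/u_{i^n}$ with $u_{i^n}=\operatorname{Tr}[\mathcal A_{i^n}(\mathbb 1/d)]$ be the post-measurement states of $\rho$ and of the maximally mixed state. Then $$\sum_{i^n}p_{i^n}\,D(\rho_{i^n}\|\sigma_{i^n})\;\ge\;S_{\mathcal C^n}(\rho)-S_{\mathcal C^{n+1}}(\rho)\;=\;D_{KL}(\boldsymbol p_{n+1}\|\boldsymbol q_{n+1}).$$ Terms of the sum with $p_{i^n}=0$ count as $0$. Here $D(\rho\|\sigma)=\operatorname{Tr}[\rho\ln\rho]-\operatorname{Tr}[\rho\ln\sigma]$ if $\operatorname{supp}\rho\subseteq\operatorname{supp}\sigma$ and $+\infty$ otherwise, where the support is the orthogonal complement of the kernel, and $D_{KL}(\boldsymbol p\|\boldsymbol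 q)=\sum_x p_x\ln(p_x/q_x)$ (with $0\ln 0=0$) if $q_x=0$ implies $p_x=0$ and $+\infty$ otherwise. -/

import Mathlib

open scoped MatrixOrder Matrix.Norms.L2Operator CStarAlgebra ComplexOrder

namespace ObservationalEntropy

universe u v

section Basic

variable {H K : Type*} [Fintype H] [DecidableEq H] [Fintype K]

/-- Density matrices: positive semidefinite matrices of unit trace. -/
structure IsState (ρ : Matrix H H ℂ) : Prop where
  posSemidef : ρ.PosSemidef
  trace_eq_one : ρ.trace = 1

/-- The support of an operator: the orthogonal complement of its kernel. -/
noncomputable def supp (A : Matrix H H ℂ) : Submodule ℂ (EuclideanSpace ℂ H) :=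
  (LinearMap.ker (Matrix.toEuclideanLin A))ᗮ

open Classical in
/-- Umegaki's quantum relative entropy `D(ρ‖σ)`, with values in the extended reals. The functional
calculus of `Real.log` vanishes on the kernel, so that `0 ln 0 = 0`, and on the support condition
`Tr[ρ ln σ]` only involves `σ` on its support. -/
noncomputable def relEntropy (ρ σ : Matrix H H ℂ) : EReal :=
  if supp ρ ≤ supp σ then
    (((ρ * CFC.log ρ).trace - (ρ * CFC.log σ).trace).re : EReal)
  else ⊤

open Classical in
/-- The Kullback-Leibler divergence of two vectors of probabilities, with values in the extended
reals (and with `0 ln 0 = 0`). -/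
noncomputable def klDivergence {X : Type*} [Fintype X] (p q : X → ℝ) : EReal :=
  if ∀ x, q x = 0 → p x = 0 then ((∑ x, p x * Real.log (p x / q x) : ℝ) : EReal) else ⊤

/-- The maximally mixed state `𝟙 / d`, where `d` is the dimension. -/
noncomputable def maxMixed (H : Type*) [Fintype H] [DecidableEq H] : Matrix H H ℂ :=
  ((Fintype.card H : ℂ)⁻¹) • (1 : Matrix H H ℂ)

/-- The trace-dual of a linear map, characterized by `Tr[Y A(X)] = Tr[A†(Y) X]`,
see `trace_mul_traceDual`. -/
noncomputable def traceDual (A : Matrix H H ℂ →ₗ[ℂ] Matrix K K ℂ) (Y : Matrix K K ℂ) :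
    Matrix H H ℂ :=
  Matrix.of fun a b => (Y * A (Matrix.single b a 1)).trace

theorem trace_mul_traceDual (A : Matrix H H ℂ →ₗ[ℂ] Matrix K K ℂ) (Y : Matrix K K ℂ)
    (X : Matrix H H ℂ) : (Y * A X).trace = (traceDual A Y * X).trace := by
  have hX : X = ∑ b, ∑ a, X b a • Matrix.single b a (1 : ℂ) := by
    conv_lhs => rw [Matrix.matrix_eq_sum_single X]
    simp [Matrix.smul_single]
  conv_lhs => rw [hX]
  simp only [map_sum, map_smul, Matrix.mul_sum, Matrix.mul_smul, Matrix.trace_sum,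
    Matrix.trace_smul, smul_eq_mul]
  rw [Finset.sum_comm]
  simp only [traceDual, Matrix.trace, Matrix.diag, Matrix.mul_apply, Matrix.of_apply]
  exact Finset.sum_congr rfl fun a _ => Finset.sum_congr rfl fun b _ => mul_comm _ _

end Basic

/-- A coarse-graining (quantum instrument) with finite outcome set `I`, from operators on `ℂ^H` to
operators on `ℂ^K`: a family of completely positive maps whose sum is trace-preserving. -/
structure CoarseGraining (H K I : Type*) [Fintype H] [DecidableEq H] [Fintype K] [DecidableEq K]
    [Fintype I] where
  op : I → (Matrix H H ℂ →CP Matrix K K ℂ)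
  trace_sum : ∀ X : Matrix H H ℂ, (∑ i, op i X).trace = X.trace

/-- A sequence of `n` coarse-grainings, the `k`-th one mapping the `k`-th system to the next one. -/
abbrev CoarseGrainingSeq {n : ℕ} (H : Fin (n + 1) → Type u) (I : Fin n → Type v)
    [∀ k, Fintype (H k)] [∀ k, DecidableEq (H k)] [∀ k, Fintype (I k)] :=
  ∀ k : Fin n, CoarseGraining (H k.castSucc) (H k.succ) (I k)

/-- The sequence obtained by dropping the last coarse-graining. -/
abbrev CoarseGrainingSeq.init {n : ℕ} {H : Fin (n + 2) → Type u} {I : Fin (n + 1) → Type v}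
    [∀ k, Fintype (H k)] [∀ k, DecidableEq (H k)] [∀ k, Fintype (I k)]
    (C : CoarseGrainingSeq H I) :
    CoarseGrainingSeq (fun k : Fin (n + 1) => H k.castSucc) (fun k : Fin n => I k.castSucc) :=
  fun k => C k.castSucc

/-- The operation `A_{i^n}`: the composition of the operations of the successive outcomes
`i^n = (i_1, …, i_n)`, the first one being applied first. -/
noncomputable def seqOp : {n : ℕ} → {H : Fin (n + 1) → Type u} → {I : Fin n → Type v} →
    [∀ k, Fintype (H k)] → [∀ k, DecidableEq (H k)] → [∀ k, Fintype (I k)] →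
    CoarseGrainingSeq H I → (∀ k, I k) →
    (Matrix (H 0) (H 0) ℂ →ₗ[ℂ] Matrix (H (Fin.last n)) (H (Fin.last n)) ℂ)
  | 0, _, _, _, _, _, _, _ => LinearMap.id
  | n + 1, _, _, _, _, _, C, i =>
      ((C (Fin.last n)).op (i (Fin.last n))).toLinearMap ∘ₗ
        seqOp (CoarseGrainingSeq.init C) (Fin.init i)

section Sequences

variable {n : ℕ} {H : Fin (n + 1) → Type u} {I : Fin n → Type v}
  [∀ k, Fintype (H k)] [∀ k, DecidableEq (H k)] [∀ k, Fintype (I k)]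

/-- The probability `p_{i^n} = Tr[A_{i^n}(ρ)]` of the outcome `i^n`. -/
noncomputable def prob (C : CoarseGrainingSeq H I) (ρ : Matrix (H 0) (H 0) ℂ) (i : ∀ k, I k) : ℝ :=
  (seqOp C i ρ).trace.re

/-- The POVM element `Π_{i^n} = A_{i^n}†(𝟙)`. -/
noncomputable def povm (C : CoarseGrainingSeq H I) (i : ∀ k, I k) : Matrix (H 0) (H 0) ℂ :=
  traceDual (seqOp C i) 1

/-- The volume `V_{i^n} = Tr[Π_{i^n}]`. -/
noncomputable def vol (C : CoarseGrainingSeq H I) (i : ∀ k, I k) : ℝ :=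
  (povm C i).trace.re

/-- The observational entropy `S_{C^n}(ρ)`. -/
noncomputable def obsEntropy (C : CoarseGrainingSeq H I) (ρ : Matrix (H 0) (H 0) ℂ) : ℝ :=
  -∑ i, prob C ρ i * Real.log (prob C ρ i / vol C i)

/-- The post-measurement state `A_{i^n}(ρ) / p_{i^n}`. (If the outcome has probability zero, this
is the zero matrix; it is only used with weight `p_{i^n}`.) -/
noncomputable def postState (C : CoarseGrainingSeq H I) (ρ : Matrix (H 0) (H 0) ℂ)
    (i : ∀ k, I k) : Matrix (H (Fin.last n)) (H (Fin.last n)) ℂ :=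
  ((prob C ρ i : ℂ)⁻¹) • seqOp C i ρ

/-- The mean quantum relative entropy `∑ p_{i^n} D(ρ_{i^n}‖σ_{i^n})` between the post-measurement
states of `ρ` and those of the maximally mixed state. -/
noncomputable def meanRelEntropy (C : CoarseGrainingSeq H I) (ρ : Matrix (H 0) (H 0) ℂ) : EReal :=
  ∑ i, (prob C ρ i : EReal) * relEntropy (postState C ρ i) (postState C (maxMixed (H 0)) i)

end Sequences

/-- The vector `q_{n+1}`, with entries `V(i_{n+1}|i^n) p_{i^n}`, where
`V(i_{n+1}|i^n) = V_{i^{n+1}} / V_{i^n}` is the conditional volume. -/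
noncomputable def qVec {n : ℕ} {H : Fin (n + 2) → Type u} {I : Fin (n + 1) → Type v}
    [∀ k, Fintype (H k)] [∀ k, DecidableEq (H k)] [∀ k, Fintype (I k)]
    (C : CoarseGrainingSeq H I) (ρ : Matrix (H 0) (H 0) ℂ) (i : ∀ k, I k) : ℝ :=
  vol C i / vol (CoarseGrainingSeq.init C) (Fin.init i) *
    prob (CoarseGrainingSeq.init C) ρ (Fin.init i)

end ObservationalEntropy

open ObservationalEntropy

namespace ObservationalEntropy

universe u v

/-! ### Functions of two Hermitian matrices in their eigenbases. -/

section Spectral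

variable {K : Type*} [Fintype K] [DecidableEq K]

/-! The equality is a chain rule: `qVec` is built so that p/q is the quotient of the ratios p/V at
the two levels, and summing over the last outcome restores the probabilities at level n
(`obsEntropy_init_sub_obsEntropy`).

For the inequality, fix the first n outcomes. The effects of the last coarse-graining form a POVM.
Measured in the post-measurement state of ρ it gives the conditional probabilities; measured in that
of the maximally mixed state it gives the conditional volumes. The bound is then monotonicity of
relative entropy under a measurement (`sum_mul_log_le_relEntropy`), weighted by the probability of
the first outcomes.

Monotonicity is proved without operator convexity of the logarithm. With eigenvalues r_i, s_k of ρ,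
σ and squared overlaps w_ik, the relative entropy is the classical divergence of P = r_i w_ik from Q
= s_k w_ik. It suffices to compare ∑ p²/(q + t p) with ∑ P²/(Q + t P) for each t > 0 and integrate
in t (`sum_mul_log_le_of_forall_sum_sq_div_le`). The functional 2 Tr ρX − Tr σX² − t Tr ρX² lies
below the second sum for every Hermitian X (`two_mul_trace_sub_le_sum_overlap`), and above the first
for a suitable combination X of the effects, by Kadison's inequality (`trace_mul_sum_smul_sq_le`).
-/

theorem trace_mul_nonneg {A B : Matrix K K ℂ} (hA : A.PosSemidef) (hB : B.PosSemidef) :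
    0 ≤ (A * B).trace := by
  obtain ⟨C, rfl⟩ := CStarAlgebra.nonneg_iff_eq_star_mul_self.mp hA.nonneg
  rw [Matrix.mul_assoc, Matrix.trace_mul_comm]
  exact (hB.mul_mul_conjTranspose_same C).trace_nonneg

theorem trace_mul_re_nonneg {A B : Matrix K K ℂ} (hA : A.PosSemidef) (hB : B.PosSemidef) :
    0 ≤ (A * B).trace.re :=
  (Complex.le_def.mp (trace_mul_nonneg hA hB)).1

theorem hermitianCfc_eq_mul_diagonal_mul {A : Matrix K K ℂ} (hA : A.IsHermitian) (f : ℝ → ℝ) :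
    hA.cfc f = (hA.eigenvectorUnitary : Matrix K K ℂ) *
      Matrix.diagonal (fun i => (f (hA.eigenvalues i) : ℂ)) *
        star (hA.eigenvectorUnitary : Matrix K K ℂ) :=
  rfl

theorem hermitianCfc_id {A : Matrix K K ℂ} (hA : A.IsHermitian) : hA.cfc id = A :=
  hA.spectral_theorem.symm

theorem hermitianCfc_one {A : Matrix K K ℂ} (hA : A.IsHermitian) : hA.cfc (fun _ => 1) = 1 := by
  simp [hermitianCfc_eq_mul_diagonal_mul]

theorem mul_hermitianCfc {A : Matrix K K ℂ} (hA : A.IsHermitian) (f : ℝ → ℝ) :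
    A * hA.cfc f = hA.cfc (fun x => x * f x) := by
  conv_lhs => enter [1]; rw [← hermitianCfc_id hA]
  simp only [Matrix.IsHermitian.cfc, ← map_mul, Matrix.diagonal_mul_diagonal]
  congr 2
  ext i
  simp

theorem log_eq_hermitianCfc {A : Matrix K K ℂ} (hA : A.IsHermitian) :
    CFC.log A = hA.cfc Real.log :=
  hA.cfc_eq Real.log

/-- The trace of a product involving functions of two Hermitian matrices, in terms of their
eigenvalues and of the matrix entries between the two eigenbases. -/
theorem trace_hermitianCfc_mul_mul {A B : Matrix K K ℂ} (hA : A.IsHermitian) (hB : B.IsHermitian)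
    (f g : ℝ → ℝ) (M N : Matrix K K ℂ) :
    (hA.cfc f * M * hB.cfc g * N).trace = ∑ i, ∑ k,
      (f (hA.eigenvalues i) : ℂ) * (g (hB.eigenvalues k) : ℂ) *
        ((star (hA.eigenvectorUnitary : Matrix K K ℂ) * M * hB.eigenvectorUnitary) i k *
          (star (hB.eigenvectorUnitary : Matrix K K ℂ) * N * hA.eigenvectorUnitary) k i) := by
  rw [hermitianCfc_eq_mul_diagonal_mul hA, hermitianCfc_eq_mul_diagonal_mul hB]
  set U : Matrix K K ℂ := ↑hA.eigenvectorUnitary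
  set V : Matrix K K ℂ := ↑hB.eigenvectorUnitary
  have : U * Matrix.diagonal (fun i => (f (hA.eigenvalues i) : ℂ)) * star U * M *
      (V * Matrix.diagonal (fun i => (g (hB.eigenvalues i) : ℂ)) * star V) * N =
      U * (Matrix.diagonal (fun i => (f (hA.eigenvalues i) : ℂ)) * (star U * M * V) *
        Matrix.diagonal (fun i => (g (hB.eigenvalues i) : ℂ)) * (star V * N)) := by
    simp only [Matrix.mul_assoc]
  rw [this, Matrix.trace_mul_comm, Matrix.mul_assoc _ (star V * N) U]
  simp only [Matrix.trace, Matrix.diag, Matrix.mul_apply (M := _ * Matrix.diagonal _),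
    Matrix.mul_diagonal, Matrix.diagonal_mul]
  exact Finset.sum_congr rfl fun i _ => Finset.sum_congr rfl fun k _ => by ring

theorem eigenbasis_entry_swap {A B M : Matrix K K ℂ} (hA : A.IsHermitian) (hB : B.IsHermitian)
    (hM : M.IsHermitian) (i k : K) :
    (star (hA.eigenvectorUnitary : Matrix K K ℂ) * M * hB.eigenvectorUnitary) i k =
      star ((star (hB.eigenvectorUnitary : Matrix K K ℂ) * M * hA.eigenvectorUnitary) k i) := by
  rw [← Matrix.conjTranspose_apply]
  simp only [Matrix.conjTranspose_mul, Matrix.star_eq_conjTranspose,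
    Matrix.conjTranspose_conjTranspose, hM.eq, Matrix.mul_assoc]

end Spectral

/-! ### Classical divergences as integrals over t. -/

open Filter Topology in
theorem tendsto_mul_log_add_mul_sub {p q : ℝ} (hp : 0 ≤ p) :
    Tendsto (fun t : ℝ => p * (Real.log (q + t * p) - Real.log p - Real.log (1 + t)))
      atTop (𝓝 0) := by
  rcases hp.eq_or_lt with rfl | hp
  · simp
  have h1 : Tendsto (fun t : ℝ => 1 + (q / p - 1) * (1 + t)⁻¹) atTop (𝓝 (1 + (q / p - 1) * 0)) :=
    ((tendsto_inv_atTop_zero.comp (tendsto_atTop_add_const_left _ 1 tendsto_id)).const_mul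
      _).const_add 1
  rw [mul_zero, add_zero] at h1
  have h2 := ((Real.continuousAt_log one_ne_zero).tendsto.comp h1).const_mul p
  rw [Real.log_one, mul_zero] at h2
  refine h2.congr' ?_
  filter_upwards [eventually_gt_atTop 0, eventually_gt_atTop (-q / p)] with t ht htq
  have hpos : 0 < q + t * p := by
    rw [div_lt_iff₀ hp] at htq
    linarith
  have h1t : 0 < 1 + t := by linarith
  simp only [Function.comp_apply]
  rw [← Real.log_div hpos.ne' hp.ne', ← Real.log_div (by positivity) h1t.ne']
  congr 2
  field_simp
  ring

theorem hasDerivAt_mul_log_add_mul_sub {p q t : ℝ} (hp : 0 ≤ p) (hq : 0 ≤ q)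
    (hpq : q = 0 → p = 0) (ht : 0 ≤ t) :
    HasDerivAt (fun t : ℝ => p * (Real.log (q + t * p) - Real.log p - Real.log (1 + t)))
      (p ^ 2 / (q + t * p) - p / (1 + t)) t := by
  rcases hp.eq_or_lt with rfl | hp
  · simpa using hasDerivAt_const t (0 : ℝ)
  have hq' : 0 < q := hq.lt_of_ne fun h => hp.ne' (hpq h.symm)
  have h1 : HasDerivAt (fun t : ℝ => q + t * p) p t := by
    simpa using ((hasDerivAt_id t).mul_const p).const_add q
  have h2 : HasDerivAt (fun t : ℝ => 1 + t) 1 t := (hasDerivAt_id t).const_add 1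
  have h := (((h1.log (by positivity)).sub_const (Real.log p)).sub
    (h2.log (by positivity))).const_mul p
  exact h.congr_deriv (by ring)

open Filter Topology in
/-- An integrated form of a comparison of `f`-divergences: a domination between the functions
`∑ x² / (y + t x)` for all `t` entails a domination of relative entropies. -/
theorem sum_mul_log_le_of_forall_sum_sq_div_le {X Y : Type*} [Fintype X] [Fintype Y]
    {p q : X → ℝ} {P Q : Y → ℝ} (hp : ∀ x, 0 ≤ p x) (hq : ∀ x, 0 ≤ q x) (hP : ∀ y, 0 ≤ P y)
    (hQ : ∀ y, 0 ≤ Q y) (hpq : ∀ x, q x = 0 → p x = 0) (hPQ : ∀ y, Q y = 0 → P y = 0)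
    (hsum : ∑ x, p x = ∑ y, P y)
    (h : ∀ t, 0 < t → ∑ x, p x ^ 2 / (q x + t * p x) ≤ ∑ y, P y ^ 2 / (Q y + t * P y)) :
    ∑ x, p x * Real.log (p x / q x) ≤ ∑ y, P y * Real.log (P y / Q y) := by
  -- `F` tends to 0 at infinity, thanks to the `log (1 + t)` terms. Their derivatives cancel because
  -- the total masses agree, so `F` increases by `h`; hence `F 0 ≤ 0`, which is the claim.
  set F : ℝ → ℝ := fun t =>
    ∑ y, P y * (Real.log (Q y + t * P y) - Real.log (P y) - Real.log (1 + t)) -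
      ∑ x, p x * (Real.log (q x + t * p x) - Real.log (p x) - Real.log (1 + t)) with hF
  have hlim : Tendsto F atTop (𝓝 0) := by
    simpa using (tendsto_finsetSum Finset.univ fun y _ =>
      tendsto_mul_log_add_mul_sub (q := Q y) (hP y)).sub
        (tendsto_finsetSum Finset.univ fun x _ => tendsto_mul_log_add_mul_sub (q := q x) (hp x))
  have hderiv : ∀ t, 0 ≤ t → HasDerivAt F
      (∑ y, (P y ^ 2 / (Q y + t * P y) - P y / (1 + t)) -
        ∑ x, (p x ^ 2 / (q x + t * p x) - p x / (1 + t))) t := fun t ht =>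
    (HasDerivAt.fun_sum fun y _ =>
      hasDerivAt_mul_log_add_mul_sub (hP y) (hQ y) (hPQ y) ht).sub
        (HasDerivAt.fun_sum fun x _ =>
          hasDerivAt_mul_log_add_mul_sub (hp x) (hq x) (hpq x) ht)
  have hmono : MonotoneOn F (Set.Ici 0) := by
    refine monotoneOn_of_deriv_nonneg (convex_Ici 0)
      (fun t ht => (hderiv t ht).continuousAt.continuousWithinAt)
      (fun t ht => (hderiv t (interior_subset ht)).differentiableAt.differentiableWithinAt) ?_
    intro t ht
    rw [interior_Ici] at ht
    rw [(hderiv t ht.le).deriv]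
    simp only [Finset.sum_sub_distrib, ← Finset.sum_div, hsum]
    linarith [h t ht]
  have h0 : F 0 ≤ 0 := ge_of_tendsto hlim <| by
    filter_upwards [eventually_ge_atTop 0] with t ht
    exact hmono Set.self_mem_Ici ht ht
  have key : ∀ a b : ℝ, (b = 0 → a = 0) →
      a * (Real.log (b + 0 * a) - Real.log a - Real.log (1 + 0)) = -(a * Real.log (a / b)) := by
    intro a b hab
    by_cases ha : a = 0
    · simp [ha]
    · rw [Real.log_div ha (mt hab ha)]
      simp
      ring
  simp only [hF, key _ _ (hPQ _), key _ _ (hpq _), Finset.sum_neg_distrib] at h0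
  linarith

/-- Complete the square in ‖x‖. The right side keeps the common factor ‖u‖² so as to match the terms
P²/(Q + tP); the degenerate cases rely on `0 / 0 = 0`. -/
theorem two_mul_mul_re_sub_le {r s t : ℝ} (hr : 0 ≤ r) (hs : 0 ≤ s) (ht : 0 < t) (u x : ℂ) :
    2 * (r * (star u * x).re) - s * ‖x‖ ^ 2 - t * (r * ‖x‖ ^ 2) ≤
      (r * ‖u‖ ^ 2) ^ 2 / (s * ‖u‖ ^ 2 + t * (r * ‖u‖ ^ 2)) := by
  have hre : (star u * x).re ≤ ‖u‖ * ‖x‖ := by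
    simpa using Complex.re_le_norm (star u * x)
  have hmul := mul_le_mul_of_nonneg_left hre hr
  rcases (norm_nonneg u).eq_or_lt with hu | hu
  · rw [← hu] at hmul ⊢
    have : 0 ≤ t * (r * ‖x‖ ^ 2) := by positivity
    have : 0 ≤ s * ‖x‖ ^ 2 := by positivity
    norm_num at hmul ⊢
    linarith
  rcases hr.eq_or_lt with rfl | hr
  · have : 0 ≤ s * ‖x‖ ^ 2 := by positivity
    norm_num
    linarith
  have hpos : 0 < s + t * r := by positivity
  have : (r * ‖u‖ ^ 2) ^ 2 / (s * ‖u‖ ^ 2 + t * (r * ‖u‖ ^ 2)) = (r * ‖u‖) ^ 2 / (s + t * r) := by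
    field_simp
  rw [this, le_div_iff₀ hpos]
  nlinarith [sq_nonneg (r * ‖u‖ - (s + t * r) * ‖x‖)]

theorem isHermitian_sum_smul {K J : Type*} [Fintype J] {E : J → Matrix K K ℂ}
    (hE : ∀ j, (E j).PosSemidef) (c : J → ℝ) : (∑ j, (c j : ℂ) • E j).IsHermitian := by
  simp [Matrix.IsHermitian, Matrix.conjTranspose_sum, Matrix.conjTranspose_smul,
    fun j => (hE j).1.eq]

/-! ### Monotonicity of relative entropy under a measurement. -/

section Measurement

variable {K : Type*} [Fintype K] [DecidableEq K]

/-- The Kadison inequality `(∑ cⱼ Eⱼ)² ≤ ∑ cⱼ² Eⱼ` for a POVM, tested against a positive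
matrix. -/
theorem trace_mul_sum_smul_sq_le {J : Type*} [Fintype J] {E : J → Matrix K K ℂ}
    (hE : ∀ j, (E j).PosSemidef) (hsum : ∑ j, E j = 1) (c : J → ℝ) {ω : Matrix K K ℂ}
    (hω : ω.PosSemidef) :
    (ω * (∑ j, (c j : ℂ) • E j) * (∑ j, (c j : ℂ) • E j)).trace.re ≤
      ∑ j, c j ^ 2 * (E j * ω).trace.re := by
  set X := ∑ j, (c j : ℂ) • E j with hX
  have hXh : X.IsHermitian := isHermitian_sum_smul hE c
  -- An operator variance: ∑ (cⱼ − X) Eⱼ (cⱼ − X) = ∑ cⱼ² Eⱼ − X², a sum of positive terms.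
  have hpos : ∀ j, 0 ≤ (ω * (((c j : ℂ) • (1 : Matrix K K ℂ) - X) * E j *
      ((c j : ℂ) • (1 : Matrix K K ℂ) - X))).trace.re := fun j => by
    refine trace_mul_re_nonneg hω ?_
    have := (hE j).mul_mul_conjTranspose_same ((c j : ℂ) • (1 : Matrix K K ℂ) - X)
    rwa [Matrix.conjTranspose_sub, hXh.eq, Matrix.conjTranspose_smul, Matrix.conjTranspose_one,
      Complex.star_def, Complex.conj_ofReal] at this
  have hexp : ∑ j, ((c j : ℂ) • (1 : Matrix K K ℂ) - X) * E j *
      ((c j : ℂ) • (1 : Matrix K K ℂ) - X) = ∑ j, ((c j : ℂ) ^ 2) • E j - X * X := by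
    have : ∀ j, ((c j : ℂ) • (1 : Matrix K K ℂ) - X) * E j * ((c j : ℂ) • (1 : Matrix K K ℂ) - X) =
        ((c j : ℂ) ^ 2) • E j - ((c j : ℂ) • E j) * X - X * ((c j : ℂ) • E j) + X * E j * X := by
      intro j
      simp only [Matrix.sub_mul, Matrix.mul_sub, Matrix.smul_mul, Matrix.mul_smul, Matrix.one_mul,
        Matrix.mul_one, smul_sub, smul_smul, sq]
      abel
    simp only [this, Finset.sum_add_distrib, Finset.sum_sub_distrib, ← Matrix.sum_mul,
      ← Matrix.mul_sum, hsum, ← hX, Matrix.mul_one]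
    abel
  have h := Finset.sum_nonneg fun j (_ : j ∈ Finset.univ) => hpos j
  rw [← Complex.re_sum, ← Matrix.trace_sum, ← Matrix.mul_sum, hexp, Matrix.mul_sub,
    Matrix.trace_sub, Complex.sub_re, Matrix.mul_sum, Matrix.trace_sum, Complex.re_sum,
    ← Matrix.mul_assoc, sub_nonneg] at h
  refine h.trans_eq (Finset.sum_congr rfl fun j _ => ?_)
  rw [Matrix.mul_smul, Matrix.trace_smul, smul_eq_mul, Matrix.trace_mul_comm,
    ← Complex.ofReal_pow, Complex.re_ofReal_mul]

/-- The squared overlap of two eigenvectors of a pair of Hermitian matrices. -/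
noncomputable def overlap {ρ σ : Matrix K K ℂ} (hρ : ρ.IsHermitian) (hσ : σ.IsHermitian)
    (z : K × K) : ℝ :=
  ‖(star (hσ.eigenvectorUnitary : Matrix K K ℂ) * (1 : Matrix K K ℂ) *
    (hρ.eigenvectorUnitary : Matrix K K ℂ)) z.2 z.1‖ ^ 2

theorem overlap_nonneg {ρ σ : Matrix K K ℂ} (hρ : ρ.IsHermitian) (hσ : σ.IsHermitian)
    (z : K × K) : 0 ≤ overlap hρ hσ z := sq_nonneg _

theorem trace_hermitianCfc_mul_re {ρ σ : Matrix K K ℂ} (hρ : ρ.IsHermitian) (hσ : σ.IsHermitian)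
    (f g : ℝ → ℝ) :
    (hρ.cfc f * hσ.cfc g).trace.re =
      ∑ z : K × K, f (hρ.eigenvalues z.1) * g (hσ.eigenvalues z.2) * overlap hρ hσ z := by
  have h := trace_hermitianCfc_mul_mul hρ hσ f g 1 1
  rw [Matrix.mul_one, Matrix.mul_one] at h
  rw [h, Fintype.sum_prod_type]
  simp only [Complex.re_sum, eigenbasis_entry_swap hρ hσ Matrix.isHermitian_one]
  refine Finset.sum_congr rfl fun i _ => Finset.sum_congr rfl fun k _ => ?_
  rw [Complex.star_def, Complex.conj_mul', overlap]
  norm_cast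

theorem trace_re_eq_sum_overlap {ρ σ : Matrix K K ℂ} (hρ : ρ.IsHermitian) (hσ : σ.IsHermitian) :
    ρ.trace.re = ∑ z : K × K, hρ.eigenvalues z.1 * overlap hρ hσ z := by
  have h := trace_hermitianCfc_mul_re hρ hσ id (fun _ => 1)
  rw [hermitianCfc_id hρ, hermitianCfc_one hσ, Matrix.mul_one] at h
  simpa using h

theorem relEntropy_trace_eq_sum_overlap {ρ σ : Matrix K K ℂ} (hρ : ρ.IsHermitian)
    (hσ : σ.IsHermitian) :
    ((ρ * CFC.log ρ).trace - (ρ * CFC.log σ).trace).re =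
      ∑ z : K × K, hρ.eigenvalues z.1 * overlap hρ hσ z *
        (Real.log (hρ.eigenvalues z.1) - Real.log (hσ.eigenvalues z.2)) := by
  have h1 := trace_hermitianCfc_mul_re hρ hσ (fun x => x * Real.log x) (fun _ => 1)
  have h2 := trace_hermitianCfc_mul_re hρ hσ id Real.log
  rw [hermitianCfc_one hσ, Matrix.mul_one,
    ← mul_hermitianCfc] at h1
  rw [hermitianCfc_id hρ] at h2
  rw [Complex.sub_re, log_eq_hermitianCfc hρ, log_eq_hermitianCfc hσ, h1, h2, ← Finset.sum_sub_distrib]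
  exact Finset.sum_congr rfl fun z _ => by simp only [id]; ring

/-- Between the two eigenbases, all three traces become sums over pairs of eigenvectors, and the
bound holds pair by pair. -/
theorem two_mul_trace_sub_le_sum_overlap {ρ σ X : Matrix K K ℂ} (hρ : ρ.PosSemidef)
    (hσ : σ.PosSemidef) (hX : X.IsHermitian) {t : ℝ} (ht : 0 < t) :
    2 * (ρ * X).trace.re - (σ * X * X).trace.re - t * (ρ * X * X).trace.re ≤
      ∑ z : K × K, (hρ.1.eigenvalues z.1 * overlap hρ.1 hσ.1 z) ^ 2 /
        (hσ.1.eigenvalues z.2 * overlap hρ.1 hσ.1 z +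
          t * (hρ.1.eigenvalues z.1 * overlap hρ.1 hσ.1 z)) := by
  have h1 := trace_hermitianCfc_mul_mul hρ.1 hσ.1 id (fun _ => 1) 1 X
  have h2 := trace_hermitianCfc_mul_mul hρ.1 hσ.1 (fun _ => 1) id X X
  have h3 := trace_hermitianCfc_mul_mul hρ.1 hσ.1 id (fun _ => 1) X X
  rw [hermitianCfc_id hρ.1, hermitianCfc_one hσ.1, Matrix.mul_one, Matrix.mul_one] at h1
  rw [hermitianCfc_id hσ.1, hermitianCfc_one hρ.1, Matrix.one_mul, Matrix.mul_assoc,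
    Matrix.trace_mul_comm] at h2
  rw [hermitianCfc_id hρ.1, hermitianCfc_one hσ.1, Matrix.mul_one] at h3
  rw [h1, h2, h3, ← Fintype.sum_prod_type', ← Fintype.sum_prod_type', ← Fintype.sum_prod_type']
  simp only [Complex.re_sum, Finset.mul_sum, ← Finset.sum_sub_distrib]
  refine Finset.sum_le_sum fun z _ => ?_
  rw [eigenbasis_entry_swap hρ.1 hσ.1 Matrix.isHermitian_one,
    eigenbasis_entry_swap hρ.1 hσ.1 hX]
  refine le_trans (le_of_eq ?_) (two_mul_mul_re_sub_le (hρ.eigenvalues_nonneg z.1)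
    (hσ.eigenvalues_nonneg z.2) ht _
    ((star (hσ.1.eigenvectorUnitary : Matrix K K ℂ) * X * hρ.1.eigenvectorUnitary) z.2 z.1))
  simp only [id, Complex.ofReal_one, mul_one, one_mul, Complex.re_ofReal_mul, Complex.star_def,
    Complex.conj_mul']
  norm_cast

theorem mulVec_eq_zero_of_supp_le {ρ σ : Matrix K K ℂ} (h : supp ρ ≤ supp σ) {v : K → ℂ}
    (hv : σ.mulVec v = 0) : ρ.mulVec v = 0 := by
  have hker : LinearMap.ker (Matrix.toEuclideanLin σ) ≤ LinearMap.ker (Matrix.toEuclideanLin ρ) := by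
    have := Submodule.orthogonal_le h
    rwa [supp, supp, Submodule.orthogonal_orthogonal, Submodule.orthogonal_orthogonal] at this
  have hmem : WithLp.toLp 2 v ∈ LinearMap.ker (Matrix.toEuclideanLin σ) := by
    simp [LinearMap.mem_ker, Matrix.toLpLin_apply, hv]
  simpa [LinearMap.mem_ker, Matrix.toLpLin_apply] using hker hmem

/-- An eigenvector v of σ with eigenvalue 0 is also killed by ρ, so 0 = ⟨u, ρv⟩ = r⟨u, v⟩ for each
eigenvector u of ρ with eigenvalue r. This is absolute continuity of P with respect to Q. -/
theorem eigenvalue_mul_overlap_eq_zero {ρ σ : Matrix K K ℂ} (hρ : ρ.IsHermitian)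
    (hσ : σ.IsHermitian) (h : supp ρ ≤ supp σ) (z : K × K)
    (hz : hσ.eigenvalues z.2 * overlap hρ hσ z = 0) :
    hρ.eigenvalues z.1 * overlap hρ hσ z = 0 := by
  rcases mul_eq_zero.mp hz with hz | hz
  swap
  · rw [hz, mul_zero]
  have hv : ρ.mulVec (hσ.eigenvectorBasis z.2) = 0 := by
    refine mulVec_eq_zero_of_supp_le h ?_
    rw [hσ.mulVec_eigenvectorBasis, hz, zero_smul]
  have hentry := eigenbasis_entry_swap hρ hσ hρ z.1 z.2
  have hleft : (star (hρ.eigenvectorUnitary : Matrix K K ℂ) * ρ * hσ.eigenvectorUnitary) z.1 z.2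
      = 0 := by
    rw [Matrix.mul_assoc, Matrix.mul_apply]
    refine Finset.sum_eq_zero fun j _ => ?_
    rw [show (ρ * (hσ.eigenvectorUnitary : Matrix K K ℂ)) j z.2 = 0 from congrFun hv j, mul_zero]
  have hright : ρ * (hρ.eigenvectorUnitary : Matrix K K ℂ) =
      1 * hρ.eigenvectorUnitary * Matrix.diagonal (fun i => (hρ.eigenvalues i : ℂ)) := by
    have hid := hermitianCfc_eq_mul_diagonal_mul hρ id
    rw [hermitianCfc_id hρ] at hid
    refine (congrArg (· * (hρ.eigenvectorUnitary : Matrix K K ℂ)) hid).trans ?_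
    simp only [Matrix.mul_assoc, Unitary.coe_star_mul_self, Matrix.mul_one, Matrix.one_mul]
    rfl
  rw [hleft, Matrix.mul_assoc, hright, ← Matrix.mul_assoc, Matrix.mul_diagonal,
    ← Matrix.mul_assoc, eq_comm, star_eq_zero, mul_eq_zero] at hentry
  rcases hentry with h0 | h0
  · rw [overlap, h0]
    simp
  · rw [Complex.ofReal_eq_zero.mp h0, zero_mul]

/-- Monotonicity of the quantum relative entropy under measurements: the relative entropy of the
outcome distributions of a POVM is at most the relative entropy of the measured matrices. -/
theorem sum_mul_log_le_relEntropy {J : Type*} [Fintype J] {ρ σ : Matrix K K ℂ}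
    (hρ : ρ.PosSemidef) (hσ : σ.PosSemidef) {E : J → Matrix K K ℂ} (hE : ∀ j, (E j).PosSemidef)
    (hsum : ∑ j, E j = 1)
    (habs : ∀ j, (E j * σ).trace.re = 0 → (E j * ρ).trace.re = 0) :
    ((∑ j, (E j * ρ).trace.re * Real.log ((E j * ρ).trace.re / (E j * σ).trace.re) : ℝ) : EReal) ≤
      relEntropy ρ σ := by
  rw [relEntropy]
  split_ifs with hsupp
  swap
  · exact le_top
  rw [EReal.coe_le_coe_iff, relEntropy_trace_eq_sum_overlap hρ.1 hσ.1]
  have hr := hρ.eigenvalues_nonneg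
  have hs := hσ.eigenvalues_nonneg
  have hw := overlap_nonneg hρ.1 hσ.1
  have hPQ := eigenvalue_mul_overlap_eq_zero hρ.1 hσ.1 hsupp
  refine (sum_mul_log_le_of_forall_sum_sq_div_le
    (P := fun z : K × K => hρ.1.eigenvalues z.1 * overlap hρ.1 hσ.1 z)
    (Q := fun z : K × K => hσ.1.eigenvalues z.2 * overlap hρ.1 hσ.1 z)
    (fun j => trace_mul_re_nonneg (hE j) hρ) (fun j => trace_mul_re_nonneg (hE j) hσ)
    (fun z => mul_nonneg (hr _) (hw z)) (fun z => mul_nonneg (hs _) (hw z)) habs hPQ ?_ ?_).trans_eq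
    (Finset.sum_congr rfl fun z _ => ?_)
  · rw [← trace_re_eq_sum_overlap, ← Complex.re_sum, ← Matrix.trace_sum, ← Matrix.sum_mul, hsum,
      Matrix.one_mul]
  · intro t ht
    set p : J → ℝ := fun j => (E j * ρ).trace.re
    set q : J → ℝ := fun j => (E j * σ).trace.re
    -- The maximizer of 2 c p − c² (q + t p), whose maximum is p²/(q + t p).
    set c : J → ℝ := fun j => p j / (q j + t * p j) with hc
    refine le_trans ?_ (two_mul_trace_sub_le_sum_overlap hρ hσ (isHermitian_sum_smul hE c) ht)
    have h1 : (ρ * ∑ j, (c j : ℂ) • E j).trace.re = ∑ j, c j * p j := by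
      simp only [Matrix.mul_sum, Matrix.trace_sum, Complex.re_sum, Matrix.mul_smul,
        Matrix.trace_smul, smul_eq_mul, Complex.re_ofReal_mul, Matrix.trace_mul_comm ρ, p]
    have h2 := trace_mul_sum_smul_sq_le hE hsum c hσ
    have h3 := mul_le_mul_of_nonneg_left (trace_mul_sum_smul_sq_le hE hsum c hρ) ht.le
    have h4 : ∑ j, p j ^ 2 / (q j + t * p j) =
        2 * ∑ j, c j * p j - ∑ j, c j ^ 2 * q j - t * ∑ j, c j ^ 2 * p j := by
      simp only [Finset.mul_sum, ← Finset.sum_sub_distrib]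
      refine Finset.sum_congr rfl fun j _ => ?_
      by_cases h0 : q j + t * p j = 0
      · simp [hc, h0]
      · rw [show c j ^ 2 * q j = p j ^ 2 / (q j + t * p j) - t * (c j ^ 2 * p j) by
          simp only [hc]
          field_simp
          ring]
        simp only [hc]
        ring
    rw [h1, h4]
    linarith
  · by_cases hP : hρ.1.eigenvalues z.1 * overlap hρ.1 hσ.1 z = 0
    · simp [hP]
    · have hQ := mt (hPQ z) hP
      simp only [mul_eq_zero, not_or] at hP hQ
      rw [mul_div_mul_right _ _ hP.2, Real.log_div hP.1 hQ.1]

end Measurement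

/-! ### Positivity and normalization of effects and states. -/

theorem posSemidef_of_trace_mul_nonneg {K : Type*} [Fintype K] [DecidableEq K] {A : Matrix K K ℂ}
    (h : ∀ X : Matrix K K ℂ, X.PosSemidef → 0 ≤ (A * X).trace) : A.PosSemidef := by
  rw [← Matrix.isPositive_toEuclideanLin_iff, LinearMap.isPositive_iff_complex]
  intro x
  have h1 := h _ (Matrix.posSemidef_vecMulVec_self_star (WithLp.ofLp x))
  rw [Matrix.mul_vecMulVec, Matrix.trace_vecMulVec] at h1
  have h2 : inner ℂ (Matrix.toEuclideanLin A x) x =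
      star (A.mulVec (WithLp.ofLp x) ⬝ᵥ star (WithLp.ofLp x)) := by
    rw [← Matrix.star_dotProduct_star, star_star, EuclideanSpace.inner_eq_star_dotProduct]
    rfl
  rw [h2]
  have h3 := star_nonneg_iff.mpr h1
  rw [Complex.le_def] at h3
  exact ⟨Complex.ext (by simp) (by simpa using h3.2), by simpa using h3.1⟩

theorem traceDual_one_posSemidef {H K : Type*} [Fintype H] [DecidableEq H] [Fintype K]
    [DecidableEq K] {A : Matrix H H ℂ →ₗ[ℂ] Matrix K K ℂ}
    (hA : ∀ X : Matrix H H ℂ, X.PosSemidef → (A X).PosSemidef) : (traceDual A 1).PosSemidef :=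
  posSemidef_of_trace_mul_nonneg fun X hX => by
    rw [← trace_mul_traceDual, Matrix.one_mul]
    exact (hA X hX).trace_nonneg

theorem trace_traceDual_one_mul {H K : Type*} [Fintype H] [DecidableEq H] [Fintype K]
    [DecidableEq K] (A : Matrix H H ℂ →ₗ[ℂ] Matrix K K ℂ) (X : Matrix H H ℂ) :
    (traceDual A 1 * X).trace = (A X).trace := by
  rw [← trace_mul_traceDual, Matrix.one_mul]

/-- Nonnegative eigenvalues with sum 1 are at most 1. This yields p ≤ V, hence every absolute
continuity statement needed for the sequences. -/
theorem IsState.le_one {H : Type*} [Fintype H] [DecidableEq H] {ρ : Matrix H H ℂ}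
    (hρ : IsState ρ) : (1 - ρ).PosSemidef := by
  have htr : ∑ i, hρ.1.1.eigenvalues i = 1 := by
    have := hρ.1.1.trace_eq_sum_eigenvalues
    rw [hρ.2] at this
    exact Complex.ofReal_injective (by simpa using this.symm)
  have hle : ∀ i, hρ.1.1.eigenvalues i ≤ 1 := fun i =>
    htr ▸ Finset.single_le_sum (fun j _ => hρ.1.eigenvalues_nonneg j) (Finset.mem_univ i)
  set U : Matrix H H ℂ := (hρ.1.1.eigenvectorUnitary : Matrix H H ℂ) with hU
  have hdiag : 1 - ρ = U * Matrix.diagonal (fun i => ((1 - hρ.1.1.eigenvalues i : ℝ) : ℂ)) *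
      U.conjTranspose := by
    have h1 := hermitianCfc_eq_mul_diagonal_mul hρ.1.1 id
    rw [hermitianCfc_id, ← hU, Matrix.star_eq_conjTranspose] at h1
    have h2 : (1 : Matrix H H ℂ) = U * 1 * U.conjTranspose := by
      rw [Matrix.mul_one]
      exact (Unitary.coe_mul_star_self hρ.1.1.eigenvectorUnitary).symm
    conv_lhs => rw [h2]; enter [2]; rw [h1]
    rw [← Matrix.sub_mul, ← Matrix.mul_sub, ← Matrix.diagonal_one, Matrix.diagonal_sub]
    simp
  rw [hdiag]
  refine Matrix.PosSemidef.mul_mul_conjTranspose_same (Matrix.PosSemidef.diagonal fun i => ?_) U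
  exact Complex.zero_le_real.mpr (sub_nonneg.mpr (hle i))

section CoarseGraining

variable {H K I : Type*} [Fintype H] [DecidableEq H] [Fintype K] [DecidableEq K] [Fintype I]

theorem CoarseGraining.op_posSemidef (C : CoarseGraining H K I) (i : I) {X : Matrix H H ℂ}
    (hX : X.PosSemidef) : ((C.op i).toLinearMap X).PosSemidef :=
  Matrix.nonneg_iff_posSemidef.mp (map_nonneg (C.op i) (Matrix.nonneg_iff_posSemidef.mpr hX))

theorem CoarseGraining.sum_trace_op (C : CoarseGraining H K I) (X : Matrix H H ℂ) :
    ∑ i, ((C.op i).toLinearMap X).trace = X.trace := by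
  rw [← Matrix.trace_sum]
  exact C.trace_sum X

/-- Trace preservation is dual to unitality. -/
theorem CoarseGraining.sum_traceDual_one (C : CoarseGraining H K I) :
    ∑ i, traceDual (C.op i).toLinearMap 1 = 1 := by
  refine Matrix.ext_iff_trace_mul_right.mpr fun X => ?_
  rw [Matrix.sum_mul, Matrix.trace_sum, Matrix.one_mul, ← C.sum_trace_op X]
  exact Finset.sum_congr rfl fun i _ => trace_traceDual_one_mul _ X

end CoarseGraining

/-! ### Probabilities and volumes along a sequence. -/

section Sequences

theorem seqOp_posSemidef {n : ℕ} {H : Fin (n + 1) → Type u} {I : Fin n → Type v}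
    [∀ k, Fintype (H k)] [∀ k, DecidableEq (H k)] [∀ k, Fintype (I k)]
    (C : CoarseGrainingSeq H I) (i : ∀ k, I k) {X : Matrix (H 0) (H 0) ℂ} (hX : X.PosSemidef) :
    (seqOp C i X).PosSemidef := by
  induction n with
  | zero => exact hX
  | succ n ih => exact (C (Fin.last n)).op_posSemidef _ (ih C.init (Fin.init i) hX)

variable {n : ℕ} {H : Fin (n + 1) → Type u} {I : Fin n → Type v}
  [∀ k, Fintype (H k)] [∀ k, DecidableEq (H k)] [∀ k, Fintype (I k)]
  (C : CoarseGrainingSeq H I)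

theorem prob_nonneg (i : ∀ k, I k) {X : Matrix (H 0) (H 0) ℂ} (hX : X.PosSemidef) :
    0 ≤ prob C X i :=
  (Complex.le_def.mp (seqOp_posSemidef C i hX).trace_nonneg).1

theorem vol_eq_prob_one (i : ∀ k, I k) : vol C i = prob C 1 i := by
  rw [vol, povm, prob, ← trace_traceDual_one_mul, Matrix.mul_one]

theorem prob_maxMixed (i : ∀ k, I k) :
    prob C (maxMixed (H 0)) i = (Fintype.card (H 0) : ℝ)⁻¹ * vol C i := by
  rw [vol_eq_prob_one, prob, prob, maxMixed, map_smul, Matrix.trace_smul, smul_eq_mul,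
    ← Complex.re_ofReal_mul, Complex.ofReal_inv, Complex.ofReal_natCast]

theorem prob_le_vol (i : ∀ k, I k) {ρ : Matrix (H 0) (H 0) ℂ} (hρ : IsState ρ) :
    prob C ρ i ≤ vol C i := by
  have := prob_nonneg C i hρ.le_one
  rw [prob, map_sub, Matrix.trace_sub, Complex.sub_re, sub_nonneg] at this
  rw [vol_eq_prob_one]
  exact this

theorem prob_eq_zero_of_vol_eq_zero {i : ∀ k, I k} {ρ : Matrix (H 0) (H 0) ℂ} (hρ : IsState ρ)
    (h : vol C i = 0) : prob C ρ i = 0 :=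
  le_antisymm (h ▸ prob_le_vol C i hρ) (prob_nonneg C i hρ.1)

theorem postState_posSemidef (i : ∀ k, I k) {X : Matrix (H 0) (H 0) ℂ} (hX : X.PosSemidef) :
    (postState C X i).PosSemidef := by
  refine (seqOp_posSemidef C i hX).smul ?_
  have := inv_nonneg.mpr (prob_nonneg C i hX)
  exact_mod_cast this

end Sequences

/-! ### Adding one coarse-graining. -/

section Refinement

variable {n : ℕ} {H : Fin (n + 2) → Type u} {I : Fin (n + 1) → Type v}
  [∀ k, Fintype (H k)] [∀ k, DecidableEq (H k)] [∀ k, Fintype (I k)]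
  (C : CoarseGrainingSeq H I)

theorem prob_snoc (X : Matrix (H 0) (H 0) ℂ) (i : ∀ k : Fin n, I k.castSucc)
    (j : I (Fin.last n)) :
    prob C X (Fin.snoc i j) =
      (((C (Fin.last n)).op j).toLinearMap (seqOp C.init i X)).trace.re := by
  simp only [prob, seqOp, Fin.snoc_last, Fin.init_snoc]
  rfl

theorem sum_prob_snoc (X : Matrix (H 0) (H 0) ℂ) (i : ∀ k : Fin n, I k.castSucc) :
    ∑ j, prob C X (Fin.snoc i j) = prob C.init X i := by
  simp only [prob_snoc, ← Complex.re_sum]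
  rw [(C (Fin.last n)).sum_trace_op]
  rfl

theorem sum_snoc (f : (∀ k, I k) → ℝ) :
    ∑ i, f i = ∑ i : ∀ k : Fin n, I k.castSucc, ∑ j, f (Fin.snoc i j) := by
  rw [← Equiv.sum_comp (Fin.snocEquiv I), Fintype.sum_prod_type_right]
  rfl

variable {C} {ρ : Matrix (H 0) (H 0) ℂ}

theorem prob_snoc_eq_zero (hρ : IsState ρ) {i : ∀ k : Fin n, I k.castSucc}
    (h : prob C.init ρ i = 0) (j : I (Fin.last n)) : prob C ρ (Fin.snoc i j) = 0 :=
  (Finset.sum_eq_zero_iff_of_nonneg fun _ _ => prob_nonneg C _ hρ.1).mp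
    ((sum_prob_snoc C ρ i).trans h) j (Finset.mem_univ j)

theorem qVec_snoc (i : ∀ k : Fin n, I k.castSucc) (j : I (Fin.last n)) :
    qVec C ρ (Fin.snoc i j) =
      vol C (Fin.snoc i j) / vol C.init i * prob C.init ρ i := by
  rw [qVec, Fin.init_snoc]

theorem prob_eq_zero_of_qVec_eq_zero (hρ : IsState ρ) (i : ∀ k, I k) (h : qVec C ρ i = 0) :
    prob C ρ i = 0 := by
  rw [← Fin.snoc_init_self i] at h ⊢
  rw [qVec_snoc] at h
  rcases mul_eq_zero.mp h with h | h
  · rcases div_eq_zero_iff.mp h with h | h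
    · exact prob_eq_zero_of_vol_eq_zero C hρ h
    · exact prob_snoc_eq_zero hρ (prob_eq_zero_of_vol_eq_zero _ hρ h) _
  · exact prob_snoc_eq_zero hρ h _

theorem obsEntropy_init_sub_obsEntropy (hρ : IsState ρ) :
    obsEntropy C.init ρ - obsEntropy C ρ =
      ∑ i, prob C ρ i * Real.log (prob C ρ i / qVec C ρ i) := by
  have hterm : ∀ (i : ∀ k : Fin n, I k.castSucc) (j : I (Fin.last n)),
      prob C ρ (Fin.snoc i j) * Real.log (prob C ρ (Fin.snoc i j) / qVec C ρ (Fin.snoc i j)) =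
        prob C ρ (Fin.snoc i j) * Real.log (prob C ρ (Fin.snoc i j) / vol C (Fin.snoc i j)) -
          prob C ρ (Fin.snoc i j) * Real.log (prob C.init ρ i / vol C.init i) := by
    intro i j
    by_cases h : prob C ρ (Fin.snoc i j) = 0
    · simp [h]
    have hV := mt (prob_eq_zero_of_vol_eq_zero C hρ) h
    have hp : prob C.init ρ i ≠ 0 := fun h0 => h (prob_snoc_eq_zero hρ h0 j)
    have hv := mt (prob_eq_zero_of_vol_eq_zero C.init hρ) hp
    rw [← mul_sub, ← Real.log_div (div_ne_zero h hV) (div_ne_zero hp hv), qVec_snoc]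
    congr 2
    field_simp
  have hinit : obsEntropy C.init ρ =
      -∑ i, prob C.init ρ i * Real.log (prob C.init ρ i / vol C.init i) := rfl
  rw [hinit, obsEntropy, sum_snoc, sum_snoc]
  simp only [hterm, Finset.sum_sub_distrib, ← Finset.sum_mul, sum_prob_snoc]
  ring

/-- The outcome probabilities of the last coarse-graining in a post-measurement state. -/
theorem trace_traceDual_mul_postState_re (X : Matrix (H 0) (H 0) ℂ)
    (i : ∀ k : Fin n, I k.castSucc) (j : I (Fin.last n)) :
    (traceDual ((C (Fin.last n)).op j).toLinearMap 1 * postState C.init X i).trace.re =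
      prob C X (Fin.snoc i j) / prob C.init X i := by
  have hpost : postState C.init X i = ((prob C.init X i : ℂ)⁻¹) • seqOp C.init i X := rfl
  rw [trace_traceDual_one_mul, hpost, map_smul, Matrix.trace_smul, smul_eq_mul,
    ← Complex.ofReal_inv, Complex.re_ofReal_mul, div_eq_inv_mul, prob_snoc]

theorem sum_prob_mul_log_le_prob_mul_relEntropy (hρ : IsState ρ)
    (i : ∀ k : Fin n, I k.castSucc) :
    ((∑ j, prob C ρ (Fin.snoc i j) *
        Real.log (prob C ρ (Fin.snoc i j) / qVec C ρ (Fin.snoc i j)) : ℝ) : EReal) ≤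
      (prob C.init ρ i : EReal) *
        relEntropy (postState C.init ρ i) (postState C.init (maxMixed (H 0)) i) := by
  -- In `EReal`, `0 * ⊤ = 0`, so a possibly infinite relative entropy does no harm here.
  by_cases hp : prob C.init ρ i = 0
  · simp [hp, fun j => prob_snoc_eq_zero hρ hp j]
  have hv := mt (prob_eq_zero_of_vol_eq_zero C.init hρ) hp
  have hd : (Fintype.card (H 0) : ℝ) ≠ 0 := by
    intro h0
    have : IsEmpty (H 0) := Fintype.card_eq_zero_iff.mp (by exact_mod_cast h0)
    have htr := hρ.2
    simp [Matrix.trace] at htr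
  have hmix : (maxMixed (H 0)).PosSemidef := by
    refine Matrix.PosSemidef.one.smul (inv_nonneg.mpr ?_)
    exact_mod_cast Nat.zero_le _
  -- The factor 1/d cancels in conditional probabilities of the maximally mixed state, leaving
  -- conditional volumes.
  have hq : ∀ j, prob C (maxMixed (H 0)) (Fin.snoc i j) / prob C.init (maxMixed (H 0)) i =
      vol C (Fin.snoc i j) / vol C.init i := by
    intro j
    have hinit : prob C.init (maxMixed (H 0)) i =
      (Fintype.card (H 0) : ℝ)⁻¹ * vol C.init i := prob_maxMixed C.init i
    rw [prob_maxMixed, hinit]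
    exact mul_div_mul_left _ _ (inv_ne_zero hd)
  have h := sum_mul_log_le_relEntropy (postState_posSemidef C.init i hρ.1)
    (postState_posSemidef C.init i hmix)
    (fun j => traceDual_one_posSemidef fun X hX => (C (Fin.last n)).op_posSemidef j hX)
    (C (Fin.last n)).sum_traceDual_one (fun j => by
      rw [trace_traceDual_mul_postState_re, trace_traceDual_mul_postState_re, hq, div_eq_zero_iff,
        or_iff_left hv]
      intro h0
      rw [prob_eq_zero_of_vol_eq_zero C hρ h0, zero_div])
  simp only [trace_traceDual_mul_postState_re, hq] at h
  refine le_trans (le_of_eq ?_) (mul_le_mul_of_nonneg_left h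
    (EReal.coe_nonneg.mpr (prob_nonneg C.init i hρ.1)))
  rw [← EReal.coe_mul, Finset.mul_sum]
  congr 1
  refine Finset.sum_congr rfl fun j _ => ?_
  rw [qVec_snoc, ← mul_assoc, mul_div_cancel₀ _ hp, div_div, mul_comm (prob C.init ρ i)]

end Refinement

end ObservationalEntropy

open ObservationalEntropy
theorem theorem8 {n : ℕ} (hn : 1 ≤ n) {H : Fin (n + 2) → Type*} {I : Fin (n + 1) → Type*}
    [∀ k, Fintype (H k)] [∀ k, DecidableEq (H k)] [∀ k, Fintype (I k)]
    (C : CoarseGrainingSeq H I) (ρ : Matrix (H 0) (H 0) ℂ) (hρ : IsState ρ) :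
    ((obsEntropy (CoarseGrainingSeq.init C) ρ - obsEntropy C ρ : ℝ) : EReal) =
        klDivergence (prob C ρ) (qVec C ρ) ∧
      ((obsEntropy (CoarseGrainingSeq.init C) ρ - obsEntropy C ρ : ℝ) : EReal) ≤
        meanRelEntropy (CoarseGrainingSeq.init C) ρ := by
  rw [obsEntropy_init_sub_obsEntropy hρ]
  refine ⟨(if_pos (prob_eq_zero_of_qVec_eq_zero hρ)).symm, ?_⟩
  have hcoe : ∀ (s : Finset (∀ k : Fin n, I k.castSucc)) (f : (∀ k : Fin n, I k.castSucc) → ℝ),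
      ((∑ i ∈ s, f i : ℝ) : EReal) = ∑ i ∈ s, (f i : EReal) := fun s f =>
    map_sum (⟨⟨Real.toEReal, EReal.coe_zero⟩, EReal.coe_add⟩ : ℝ →+ EReal) f s
  rw [sum_snoc, hcoe]
  exact Finset.sum_le_sum fun i _ => sum_prob_mul_log_le_prob_mul_relEntropy hρ i
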